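/- Let $\psi=\Gamma'/\Gamma$ be the digamma function, $\xi(s)=\tfrac12 s(s-1)\pi^{-s/2}\Gamma(\tfrac s2)\zeta(s)$ and $\Xi(t)=\xi(\tfrac12+it)$. The function $\psi(t+1)-\log t$ is infinitely differentiable on $t>0$; for every integer $m\ge 0$ put $$\bar\psi_m(t)=\frac{d^m}{dt^m}\bigl(\psi(t+1)-\log t\bigr)\qquad(t>0).$$ Then for every integer $m\ge0$ and every real $x$ both integrals below converge absolutely, and $$(-1)^m e^{x}\int_0^\infty t^m\,\bar\psi_m(t)\,e^{-\pi t^2e^{4x}}\,dt=\frac12\int_0^\infty\frac{\Xi(t)}{\cosh(\pi t)\,(t^2+\frac14)}\left(\frac{\Gamma(\frac12-it+m)}{\Gamma(\frac12-it)}e^{-2ixt}+\frac{\Gamma(\frac12+it+m)}{\Gamma(\frac12+it)}e^{2ixt}\right)dt.$$ -/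

import Mathlib

open MeasureTheory Set
open scoped ContDiff

noncomputable section

/-- `ξ(s) = ½ s (s - 1) π^(-s/2) Γ(s/2) ζ(s)`. It is used below only on the line `Re s = 1/2`,
where every factor is given by its true value (no pole of a factor is met). -/
def riemannXi (s : ℂ) : ℂ :=
  1 / 2 * s * (s - 1) * (Real.pi : ℂ) ^ (-s / 2) * Complex.Gamma (s / 2) * riemannZeta s

/-- `Ξ(t) = ξ(1/2 + i t)`. -/
def bigXi (t : ℝ) : ℂ :=
  riemannXi (1 / 2 + Complex.I * t)

/-- `t ↦ ψ(t + 1) - log t`, where `ψ = Γ'/Γ` is the digamma function; only `t > 0` matters. -/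
def psiBarBase (t : ℝ) : ℂ :=
  Complex.digamma ((t : ℂ) + 1) - (Real.log t : ℂ)

/-- The `m`-th derivative, in the real variable `t`, of `ψ(t + 1) - log t`. -/
def psiBar (m : ℕ) (t : ℝ) : ℂ :=
  iteratedDeriv m psiBarBase t

/-- The integrand `t^m ψ̄_m(t) exp(-π t² e^(4x))`. -/
def hardyIntegrand (m : ℕ) (x t : ℝ) : ℂ :=
  (t : ℂ) ^ m * psiBar m t * (Real.exp (-Real.pi * t ^ 2 * Real.exp (4 * x)) : ℂ)

/-- The integrand containing `Ξ(t)`. -/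
def xiIntegrand (m : ℕ) (x t : ℝ) : ℂ :=
  bigXi t / ((Real.cosh (Real.pi * t) : ℂ) * ((t : ℂ) ^ 2 + 1 / 4)) *
    (Complex.Gamma (1 / 2 - Complex.I * t + m) / Complex.Gamma (1 / 2 - Complex.I * t) *
        Complex.exp (-2 * Complex.I * x * t) +
      Complex.Gamma (1 / 2 + Complex.I * t + m) / Complex.Gamma (1 / 2 + Complex.I * t) *
        Complex.exp (2 * Complex.I * x * t))

end

/-! The identity is Parseval's formula for the Mellin transform on Re s = 1/2. Put κ(u) = 1/u -
1/(e^u - 1). Binet's formula (`deriv_log_Gamma_eq`) writes ψ(t+1) - log t as the Laplace transform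
of κ, so `psiBar m` is (-1)^m times the Laplace transform of u^m κ(u).

By Fubini, the Mellin transform of t^m times that Laplace transform is Γ(s+m) times the Mellin
transform of κ at 1-s, which is -Γ(1-s)ζ(1-s) for 0 < Re s < 1 (`hasMellin_binetKernel`,
`hasMellin_pow_mul_binetLaplace`). The Gaussian contributes π^(-s/2) Γ(s/2) e^(-2xs), up to a factor
1/2. In the product at w = 1/2 + it, the reflection formula turns Γ(w) into π / (cosh(πt) Γ(1-w)),
and the remaining factors assemble into Ξ (`mellin_mul_mellin_eq_xiHalfIntegrand`).

The Fubini argument in `mellin_parseval` also gives absolute convergence on both sides. Since Ξ is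
even, folding the integral over ℝ at 0 produces the two conjugate-looking terms of `xiIntegrand`. -/

open Filter Topology

/-! ### Laplace transforms of the Binet kernel -/

/-- The kernel `1 / u - 1 / (e^u - 1)` whose Laplace transform is `ψ(t + 1) - log t`. -/
noncomputable def binetKernel (u : ℝ) : ℝ := 1 / u - 1 / (Real.exp u - 1)

lemma measurable_binetKernel : Measurable binetKernel := by
  unfold binetKernel; fun_prop

lemma binetKernel_nonneg {u : ℝ} (hu : 0 < u) : 0 ≤ binetKernel u := by
  have := Real.add_one_lt_exp hu.ne'
  exact sub_nonneg.2 (one_div_le_one_div_of_le hu (by linarith))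

lemma binetKernel_le_one {u : ℝ} (hu : 0 < u) : binetKernel u ≤ 1 := by
  have h1 := Real.add_one_lt_exp hu.ne'
  have h2 := Real.one_sub_le_exp_neg u
  have h3 : 0 < Real.exp u - 1 := by linarith
  -- Clearing denominators in the claim leaves exactly this inequality.
  have h4 : (1 - u) * Real.exp u ≤ 1 := by
    calc (1 - u) * Real.exp u ≤ Real.exp (-u) * Real.exp u := by gcongr
      _ = 1 := by rw [← Real.exp_add]; simp
  rw [binetKernel, div_sub_div _ _ hu.ne' h3.ne', div_le_one (by positivity)]
  linarith

lemma norm_binetKernel_le_one {u : ℝ} (hu : 0 < u) : ‖binetKernel u‖ ≤ 1 := by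
  rw [Real.norm_of_nonneg (binetKernel_nonneg hu)]
  exact binetKernel_le_one hu

/-- The Laplace transform of `u^k (1 / u - 1 / (e^u - 1))`. -/
noncomputable def binetLaplace (k : ℕ) (t : ℝ) : ℝ :=
  ∫ u in Ioi (0 : ℝ), u ^ k * binetKernel u * Real.exp (-(t * u))

lemma integrableOn_pow_mul_exp_neg_mul (k : ℕ) {t : ℝ} (ht : 0 < t) :
    IntegrableOn (fun u : ℝ => u ^ k * Real.exp (-(t * u))) (Ioi 0) := by
  have h := integrableOn_rpow_mul_exp_neg_mul_rpow (p := 1) (s := k) (b := t)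
    (by have : (0 : ℝ) ≤ k := k.cast_nonneg
        linarith) one_pos ht
  simpa using h

lemma integrableOn_binetLaplace (k : ℕ) {t : ℝ} (ht : 0 < t) :
    IntegrableOn (fun u : ℝ => u ^ k * binetKernel u * Real.exp (-(t * u))) (Ioi 0) := by
  refine (integrableOn_pow_mul_exp_neg_mul k ht).mono' ?_ ?_
  · exact (((measurable_id.pow_const k).mul measurable_binetKernel).mul
      (by fun_prop)).aestronglyMeasurable
  · filter_upwards [ae_restrict_mem measurableSet_Ioi] with u (hu : 0 < u)
    rw [norm_mul, norm_mul, Real.norm_of_nonneg (Real.exp_nonneg _),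
      Real.norm_of_nonneg (pow_nonneg hu.le k)]
    have := norm_binetKernel_le_one hu
    gcongr
    exact mul_le_of_le_one_right (by positivity) this

lemma hasDerivAt_binetLaplace (k : ℕ) {t : ℝ} (ht : 0 < t) :
    HasDerivAt (binetLaplace k) (-binetLaplace (k + 1) t) t := by
  have key := (hasDerivAt_integral_of_dominated_loc_of_deriv_le (𝕜 := ℝ)
    (μ := volume.restrict (Ioi (0 : ℝ))) (x₀ := t) (s := Ioi (t / 2))
    (F := fun t u => u ^ k * binetKernel u * Real.exp (-(t * u)))
    (F' := fun t u => -(u ^ (k + 1) * binetKernel u * Real.exp (-(t * u))))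
    (bound := fun u => u ^ (k + 1) * Real.exp (-((t / 2) * u)))
    (Ioi_mem_nhds (by linarith)) ?_ (integrableOn_binetLaplace k ht)
    (integrableOn_binetLaplace (k + 1) ht).1.neg ?_
    (integrableOn_pow_mul_exp_neg_mul (k + 1) (half_pos ht)) ?_).2
  · simpa only [integral_neg] using! key
  · filter_upwards [Ioi_mem_nhds ht] with s hs using (integrableOn_binetLaplace k hs).1
  · filter_upwards [ae_restrict_mem measurableSet_Ioi] with u (hu : 0 < u) s (hs : t / 2 < s)
    rw [norm_neg, norm_mul, norm_mul, Real.norm_of_nonneg (Real.exp_nonneg _),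
      Real.norm_of_nonneg (pow_nonneg hu.le _)]
    have := norm_binetKernel_le_one hu
    gcongr
    exact mul_le_of_le_one_right (by positivity) this
  · refine Eventually.of_forall fun u s _ => ?_
    have := (((hasDerivAt_id' s).mul_const u).fun_neg.exp).const_mul (u ^ k * binetKernel u)
    convert! this using 1
    ring

lemma binetLaplace_zero_nonneg (t : ℝ) : 0 ≤ binetLaplace 0 t := by
  refine setIntegral_nonneg measurableSet_Ioi fun u hu => ?_
  have := binetKernel_nonneg hu
  positivity

lemma binetLaplace_zero_le {t : ℝ} (ht : 0 < t) : binetLaplace 0 t ≤ 1 / t := by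
  have h1 : ∫ u in Ioi (0 : ℝ), Real.exp (-t * u) = 1 / t := by
    rw [integral_exp_mul_Ioi (by linarith)]; simp
  rw [← h1]
  refine setIntegral_mono_on (integrableOn_binetLaplace 0 ht)
    (integrableOn_exp_mul_Ioi (by linarith) 0) measurableSet_Ioi fun u hu => ?_
  have := binetKernel_le_one hu
  rw [pow_zero, one_mul, neg_mul]
  exact mul_le_of_le_one_left (Real.exp_nonneg _) this

lemma tendsto_binetLaplace_zero : Tendsto (binetLaplace 0) atTop (𝓝 0) := by
  refine squeeze_zero' (Eventually.of_forall binetLaplace_zero_nonneg)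
    ((eventually_gt_atTop 0).mono fun t ht => binetLaplace_zero_le ht) ?_
  exact tendsto_const_nhds.div_atTop tendsto_id

/-! ### Binet's formula for the digamma function -/

lemma integral_exp_neg_sub_exp_neg_div {a b : ℝ} (ha : 0 < a) (hb : 0 < b)
    (hint : IntegrableOn (fun u => u⁻¹ * (Real.exp (-(a * u)) - Real.exp (-(b * u)))) (Ioi 0)) :
    ∫ u in Ioi 0, u⁻¹ * (Real.exp (-(a * u)) - Real.exp (-(b * u))) = Real.log (b / a) := by
  have := Frullani.integral_Ioi_eq (f := fun x : ℝ => Real.exp (-x)) (L := 1) (R := 0)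
    (Continuous.locallyIntegrable (by fun_prop) |>.locallyIntegrableOn _) ha hb
    (by
      have : Tendsto (fun x : ℝ => Real.exp (-x)) (𝓝 0) (𝓝 (Real.exp (-0))) :=
        (by fun_prop : Continuous fun x : ℝ => Real.exp (-x)).tendsto 0
      rw [neg_zero, Real.exp_zero] at this
      exact this.mono_left nhdsWithin_le_nhds)
    (Real.tendsto_exp_neg_atTop_nhds_zero) hint
  simpa using this

/-- Since (1 - e^(-u)) κ(u) = (1 - e^(-u))/u - e^(-u), the difference of the two transforms is a
Frullani integral minus an elementary one. This is the recurrence satisfied by ψ(t+1). -/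
lemma binetLaplace_zero_add_one {t : ℝ} (ht : 0 < t) :
    binetLaplace 0 (t + 1) + Real.log (t + 1) = binetLaplace 0 t + Real.log t + 1 / (t + 1) := by
  have h0 := integrableOn_binetLaplace 0 ht
  have h1 := integrableOn_binetLaplace 0 (t := t + 1) (by linarith)
  have h2 := integrableOn_exp_mul_Ioi (a := -(t + 1)) (by linarith) 0
  have e : EqOn (fun u : ℝ => (u ^ 0 * binetKernel u * Real.exp (-(t * u)) -
        u ^ 0 * binetKernel u * Real.exp (-((t + 1) * u))) + Real.exp (-(t + 1) * u))
      (fun u => u⁻¹ * (Real.exp (-(t * u)) - Real.exp (-((t + 1) * u)))) (Ioi 0) := by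
    intro u (hu : 0 < u)
    have h3 := Real.add_one_lt_exp hu.ne'
    have h4 : Real.exp u - 1 ≠ 0 := by linarith
    have h5 : Real.exp (-(t * u)) = Real.exp (-((t + 1) * u)) * Real.exp u := by
      rw [← Real.exp_add]; ring_nf
    simp only [h5, binetKernel, neg_mul]
    field_simp
    ring
  have h3 := (integrableOn_congr_fun e measurableSet_Ioi).1 ((h0.sub h1).add h2)
  have h4 := integral_exp_neg_sub_exp_neg_div ht (by linarith : 0 < t + 1) h3
  rw [← setIntegral_congr_fun measurableSet_Ioi e, integral_add (by exact h0.sub h1) h2,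
    integral_sub h0 h1, integral_exp_mul_Ioi (by linarith),
    Real.log_div (by linarith) ht.ne'] at h4
  simp only [binetLaplace]
  rw [mul_zero, Real.exp_zero] at h4
  rw [neg_div_neg_eq] at h4
  linarith

lemma deriv_log_Gamma_add_one {t : ℝ} (ht : 0 < t) :
    deriv (Real.log ∘ Real.Gamma) (t + 1) = deriv (Real.log ∘ Real.Gamma) t + 1 / t := by
  have hder {x : ℝ} (hx : 0 < x) : DifferentiableAt ℝ (Real.log ∘ Real.Gamma) x := by
    refine ((Real.differentiableAt_Gamma ?_).log (Real.Gamma_ne_zero ?_)) <;>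
    exact fun m ↦ ne_of_gt (by have : (0 : ℝ) ≤ m := m.cast_nonneg
                               linarith)
  rw [← deriv_comp_add_const, one_div, ← Real.deriv_log,
      ← deriv_add (hder ht) (Real.differentiableAt_log ht.ne')]
  apply EventuallyEq.deriv_eq
  filter_upwards [eventually_gt_nhds ht] with x hx
  simp only [Function.comp_apply, Pi.add_apply]
  rw [Real.Gamma_add_one hx.ne', Real.log_mul hx.ne' (Real.Gamma_pos_of_pos hx).ne', add_comm]

/-- By convexity of log Γ, its derivative at t+1 lies between the slopes over [t, t+1] and [t+1,
t+2]. -/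
lemma log_le_deriv_log_Gamma {t : ℝ} (ht : 0 < t) :
    Real.log t ≤ deriv (Real.log ∘ Real.Gamma) (t + 1) ∧
      deriv (Real.log ∘ Real.Gamma) (t + 1) ≤ Real.log (t + 1) := by
  have hder {x : ℝ} (hx : 0 < x) : DifferentiableAt ℝ (Real.log ∘ Real.Gamma) x := by
    refine ((Real.differentiableAt_Gamma ?_).log (Real.Gamma_ne_zero ?_)) <;>
    exact fun m ↦ ne_of_gt (by have : (0 : ℝ) ≤ m := m.cast_nonneg
                               linarith)
  have h_rec (x : ℝ) (hx : 0 < x) :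
      (Real.log ∘ Real.Gamma) (x + 1) = (Real.log ∘ Real.Gamma) x + Real.log x := by
    simp only [Function.comp_apply]
    rw [Real.Gamma_add_one hx.ne', Real.log_mul hx.ne' (Real.Gamma_pos_of_pos hx).ne', add_comm]
  have hc := Real.convexOn_log_Gamma
  constructor
  · refine (le_of_eq ?_).trans <| hc.slope_le_deriv (mem_Ioi.mpr ht)
      (by simp only [mem_Ioi]; linarith) (lt_add_one t) (hder <| by positivity)
    rw [slope_def_field, show t + 1 - t = (1 : ℝ) by ring, div_one, h_rec t ht,
      add_sub_cancel_left]
  · refine (hc.deriv_le_slope (by simp only [mem_Ioi]; linarith)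
        (by simp only [mem_Ioi]; linarith)
        (lt_add_one (t + 1)) (hder <| by positivity)).trans (le_of_eq ?_)
    rw [slope_def_field, show t + 1 + 1 - (t + 1) = (1 : ℝ) by ring, div_one,
      h_rec (t + 1) (by positivity), add_sub_cancel_left]

/-- Binet's formula for the derivative of `log Γ`. -/
theorem deriv_log_Gamma_eq {t : ℝ} (ht : 0 < t) :
    deriv (Real.log ∘ Real.Gamma) (t + 1) = binetLaplace 0 t + Real.log t := by
  -- Both sides obey the same recurrence, so D is unchanged by integer shifts to the right; it tends
  -- to 0 at infinity, hence vanishes for positive arguments.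
  set D : ℝ → ℝ := fun t => deriv (Real.log ∘ Real.Gamma) (t + 1) - Real.log t - binetLaplace 0 t
    with hD
  have hper (n : ℕ) : D (t + n) = D t := by
    induction n with
    | zero => simp
    | succ n ih =>
      have hp : 0 < t + n := by positivity
      have h1 := deriv_log_Gamma_add_one (t := t + n + 1) (by linarith)
      have h2 := binetLaplace_zero_add_one hp
      rw [← ih]
      push_cast
      rw [← add_assoc]
      simp only [hD]
      linarith
  have hlim : Tendsto D atTop (𝓝 0) := by
    have h1 : Tendsto (fun t => deriv (Real.log ∘ Real.Gamma) (t + 1) - Real.log t) atTop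
        (𝓝 0) := by
      refine squeeze_zero' (g := fun t : ℝ => t⁻¹)
        ((eventually_gt_atTop 0).mono fun t ht => sub_nonneg.2 (log_le_deriv_log_Gamma ht).1)
        ((eventually_gt_atTop 0).mono fun t ht => ?_) tendsto_inv_atTop_zero
      have h2 := (log_le_deriv_log_Gamma ht).2
      have h3 : Real.log (t + 1) - Real.log t ≤ t⁻¹ := by
        rw [← Real.log_div (by linarith) ht.ne']
        refine (Real.log_le_sub_one_of_pos (by positivity)).trans (le_of_eq ?_)
        field_simp
        ring
      linarith
    simpa [hD] using h1.sub tendsto_binetLaplace_zero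
  have hseq : Tendsto (fun n : ℕ => D (t + n)) atTop (𝓝 0) :=
    hlim.comp (tendsto_atTop_add_const_left _ _ tendsto_natCast_atTop_atTop)
  simp only [hper] at hseq
  have := tendsto_nhds_unique hseq tendsto_const_nhds
  simp only [hD] at this
  linarith

lemma Complex.digamma_ofReal {t : ℝ} (ht : 0 < t) :
    Complex.digamma t = (deriv (Real.log ∘ Real.Gamma) t : ℝ) := by
  have hne (m : ℕ) : (t : ℂ) ≠ -m := by
    have : t ≠ -m := ne_of_gt (by have : (0 : ℝ) ≤ m := m.cast_nonneg
                                  linarith)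
    exact_mod_cast this
  have hne' (m : ℕ) : t ≠ -m := by exact_mod_cast hne m
  have h1 := (Complex.differentiableAt_Gamma t hne).hasDerivAt.comp_ofReal
  have h2 := (Real.differentiableAt_Gamma hne').hasDerivAt.ofReal_comp
  simp only [Complex.Gamma_ofReal] at h1
  have h3 := h1.unique h2
  rw [Complex.digamma_def, logDeriv_apply, h3, Complex.Gamma_ofReal, Function.comp_def,
    deriv.log (Real.differentiableAt_Gamma hne') (Real.Gamma_pos_of_pos ht).ne']
  push_cast
  rfl

theorem psiBarBase_eq {t : ℝ} (ht : 0 < t) : psiBarBase t = (binetLaplace 0 t : ℂ) := by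
  have := Complex.digamma_ofReal (t := t + 1) (by linarith)
  rw [psiBarBase, ← Complex.ofReal_one, ← Complex.ofReal_add, this, deriv_log_Gamma_eq ht]
  push_cast
  ring

theorem psiBar_eq (m : ℕ) {t : ℝ} (ht : 0 < t) :
    psiBar m t = (-1) ^ m * (binetLaplace m t : ℂ) := by
  induction m generalizing t with
  | zero => simp [psiBar, psiBarBase_eq ht]
  | succ m ih =>
    rw [psiBar, iteratedDeriv_succ]
    have h1 : psiBar m =ᶠ[𝓝 t] fun t => (-1) ^ m * (binetLaplace m t : ℂ) := by
      filter_upwards [Ioi_mem_nhds ht] with s hs using ih hs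
    have h2 := ((hasDerivAt_binetLaplace m ht).ofReal_comp.const_mul ((-1 : ℂ) ^ m))
    change deriv (psiBar m) t = _
    rw [h1.deriv_eq, h2.deriv]
    push_cast
    ring

lemma contDiffOn_binetLaplace (k n : ℕ) : ContDiffOn ℝ n (binetLaplace k) (Ioi 0) := by
  induction n generalizing k with
  | zero =>
    exact contDiffOn_zero.2 fun t ht =>
      (hasDerivAt_binetLaplace k ht).continuousAt.continuousWithinAt
  | succ n ih =>
    push_cast
    rw [contDiffOn_succ_iff_deriv_of_isOpen isOpen_Ioi]
    refine ⟨fun t ht => (hasDerivAt_binetLaplace k ht).differentiableAt.differentiableWithinAt,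
      by simp, ?_⟩
    exact (ih (k + 1)).neg.congr fun t ht => (hasDerivAt_binetLaplace k ht).deriv

theorem contDiffOn_psiBarBase : ContDiffOn ℝ ∞ psiBarBase (Ioi 0) := by
  have h : ContDiffOn ℝ ∞ (binetLaplace 0) (Ioi 0) :=
    contDiffOn_infty.2 fun n => contDiffOn_binetLaplace 0 n
  exact (Complex.ofRealCLM.contDiff.comp_contDiffOn h).congr fun t ht => psiBarBase_eq ht

/-! ### Mellin transform of the Binet kernel -/

/-- `1 / (e^u - 1)` with its singularity at the origin removed. -/
noncomputable def planckRegular (u : ℝ) : ℂ :=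
  ((1 / (Real.exp u - 1) : ℝ) : ℂ) - indicator (Ioc 0 1) (fun t : ℝ => (t : ℂ) ^ (-1 : ℂ)) u

lemma mellin_planck {s : ℂ} (hs : 1 < s.re) :
    mellin (fun u => ((1 / (Real.exp u - 1) : ℝ) : ℂ)) s =
      Complex.Gamma s * riemannZeta s := by
  have h := hasSum_mellin (a := fun _ : ℕ => 1) (p := fun n => (n : ℝ) + 1)
    (F := fun u => ((1 / (Real.exp u - 1) : ℝ) : ℂ)) (s := s)
    (fun i => Or.inr (by positivity)) (by linarith) ?_ ?_
  · rw [← h.tsum_eq, zeta_eq_tsum_one_div_nat_add_one_cpow hs, ← tsum_mul_left]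
    refine tsum_congr fun n => ?_
    push_cast
    ring
  · intro t (ht : 0 < t)
    have h1 : Real.exp (-t) < 1 := by rw [Real.exp_lt_one_iff]; linarith
    have h2 := (hasSum_geometric_of_lt_one (Real.exp_nonneg (-t)) h1).mul_left (Real.exp (-t))
    have h3 := Real.add_one_lt_exp ht.ne'
    have h4 : Real.exp (-t) * (1 - Real.exp (-t))⁻¹ = 1 / (Real.exp t - 1) := by
      rw [Real.exp_neg] at h1 ⊢
      have : Real.exp t - 1 ≠ 0 := by linarith
      have : 1 - (Real.exp t)⁻¹ ≠ 0 := by linarith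
      field_simp
    rw [h4] at h2
    convert! (Complex.hasSum_ofReal.2 h2) using 2 with n
    rw [← Real.exp_nat_mul, ← Real.exp_add]
    push_cast
    ring_nf
  · have := (summable_nat_add_iff 1).2 (Real.summable_one_div_nat_rpow.2 hs)
    simpa using this

lemma measurable_planckRegular : Measurable planckRegular := by
  unfold planckRegular
  refine Measurable.sub (by fun_prop) (Measurable.indicator ?_ measurableSet_Ioc)
  simp only [Complex.cpow_neg_one]
  fun_prop

lemma planckRegular_of_le_one {u : ℝ} (hu : 0 < u) (h1 : u ≤ 1) :
    planckRegular u = -(binetKernel u : ℂ) := by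
  rw [planckRegular, indicator_of_mem (show u ∈ Ioc (0 : ℝ) 1 from ⟨hu, h1⟩),
    Complex.cpow_neg_one, binetKernel]
  push_cast
  ring

lemma norm_planckRegular_le_of_one_lt {u : ℝ} (h1 : 1 < u) :
    ‖planckRegular u‖ ≤ 2 * Real.exp (-u) := by
  have h2 := Real.add_one_lt_exp (x := u) (by linarith)
  rw [planckRegular, indicator_of_notMem (fun h => absurd h.2 (not_le.2 h1)), sub_zero,
    Complex.norm_real, Real.norm_of_nonneg (one_div_nonneg.2 (by linarith)), Real.exp_neg,
    ← div_eq_mul_inv, div_le_div_iff₀ (by linarith) (by positivity)]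
  linarith

lemma norm_planckRegular_le_two {u : ℝ} (hu : 0 < u) : ‖planckRegular u‖ ≤ 2 := by
  rcases le_or_gt u 1 with h1 | h1
  · rw [planckRegular_of_le_one hu h1, norm_neg, Complex.norm_real]
    exact (norm_binetKernel_le_one hu).trans one_le_two
  · refine (norm_planckRegular_le_of_one_lt h1).trans ?_
    have : Real.exp (-u) ≤ 1 := Real.exp_le_one_iff.2 (by linarith)
    linarith

lemma mellinConvergent_and_differentiableAt_planckRegular {s : ℂ} (hs : 0 < s.re) :
    MellinConvergent planckRegular s ∧ DifferentiableAt ℂ (mellin planckRegular) s := by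
  have hloc : LocallyIntegrableOn planckRegular (Ioi 0) := by
    rw [locallyIntegrableOn_iff isOpen_Ioi.isLocallyClosed]
    intro K hK hKc
    exact Measure.integrableOn_of_bounded (M := 2) hKc.measure_lt_top.ne
      measurable_planckRegular.aestronglyMeasurable
      ((ae_restrict_mem hKc.measurableSet).mono fun u hu => norm_planckRegular_le_two (hK hu))
  have htop : planckRegular =O[atTop] fun t => Real.exp (-1 * t) := by
    refine Asymptotics.IsBigO.of_bound 2 ?_
    filter_upwards [eventually_gt_atTop 1] with u hu
    rw [neg_one_mul, Real.norm_of_nonneg (Real.exp_nonneg _)]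
    exact norm_planckRegular_le_of_one_lt hu
  have hbot : planckRegular =O[𝓝[>] 0] (· ^ (-0 : ℝ)) := by
    refine Asymptotics.IsBigO.of_bound 2 ?_
    filter_upwards [self_mem_nhdsWithin] with u hu
    simpa using norm_planckRegular_le_two hu
  exact ⟨mellinConvergent_of_isBigO_rpow_exp one_pos hloc htop hbot hs,
    mellin_differentiableAt_of_isBigO_rpow_exp one_pos hloc htop hbot hs⟩

lemma mellin_planckRegular_of_one_lt {s : ℂ} (hs : 1 < s.re) :
    mellin planckRegular s = Complex.Gamma s * riemannZeta s - 1 / (s - 1) := by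
  have h1 := hasMellin_cpow_Ioc (-1) (s := s) (by simpa using hs)
  have h2 := (mellinConvergent_and_differentiableAt_planckRegular (s := s) (by linarith)).1
  have h3 := (hasMellin_add h2 h1.1).2
  rw [h1.2] at h3
  simp only [planckRegular, sub_add_cancel] at h3
  rw [mellin_planck hs] at h3
  rw [h3, ← sub_eq_add_neg]
  simp

/-- Analytic continuation from Re s > 1 to Re s > 0, after multiplying by s - 1 to remove the pole
at 1. -/
lemma mellin_planckRegular {s : ℂ} (hs : 0 < s.re) (h1 : s ≠ 1) :
    mellin planckRegular s = Complex.Gamma s * riemannZeta s - 1 / (s - 1) := by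
  set U : Set ℂ := {z | 0 < z.re} with hU
  have hUo : IsOpen U := isOpen_lt continuous_const Complex.continuous_re
  have hUc : IsPreconnected U := (convex_halfSpace_re_gt 0).isPreconnected
  -- `riemannZeta` has a junk value at 1, so (z - 1) Γ(z) ζ(z) as written is not analytic there. `G`
  -- is its continuation, built from the entire functions `completedRiemannZeta₀` and 1/`Gammaℝ`.
  set F : ℂ → ℂ := fun z => (z - 1) * mellin planckRegular z + 1 with hF
  set G : ℂ → ℂ := fun z => Complex.Gamma z *
    (((z - 1) * completedRiemannZeta₀ z - (z - 1) / z + 1) * (Complex.Gammaℝ z)⁻¹) with hG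
  have hne0 {z : ℂ} (hz : z ∈ U) : z ≠ 0 := by
    rintro rfl
    simp [hU] at hz
  have hGζ {z : ℂ} (hz : z ∈ U) (hz1 : z ≠ 1) :
      G z = (z - 1) * (Complex.Gamma z * riemannZeta z) := by
    have h0 := hne0 hz
    have h2 : z - 1 ≠ 0 := sub_ne_zero.2 hz1
    have h3 : 1 - z ≠ 0 := sub_ne_zero.2 hz1.symm
    rw [riemannZeta_def_of_ne_zero h0, completedRiemannZeta_eq]
    simp only [hG]
    have : (z - 1) * (completedRiemannZeta₀ z - 1 / z - 1 / (1 - z)) =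
        (z - 1) * completedRiemannZeta₀ z - (z - 1) / z + 1 := by
      rw [← neg_sub z 1]
      field_simp
      ring
    rw [← this, div_eq_mul_inv _ (Complex.Gammaℝ z)]
    ring
  have hFa : AnalyticOnNhd ℂ F U := by
    refine DifferentiableOn.analyticOnNhd (fun z hz => ?_) hUo
    have := (mellinConvergent_and_differentiableAt_planckRegular hz).2
    exact (((differentiableAt_id.sub_const 1).mul this).add_const 1).differentiableWithinAt
  have hGa : AnalyticOnNhd ℂ G U := by
    refine DifferentiableOn.analyticOnNhd (fun z hz => ?_) hUo
    have h0 := hne0 hz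
    have hΓ : DifferentiableAt ℂ Complex.Gamma z :=
      Complex.differentiableAt_Gamma z fun m h => by
        have h' : 0 < z.re := hz
        rw [h] at h'
        simp only [Complex.neg_re, Complex.natCast_re] at h'
        have : (0 : ℝ) ≤ m := m.cast_nonneg
        linarith
    have hΛ : DifferentiableAt ℂ completedRiemannZeta₀ z := differentiable_completedZeta₀ z
    have hR : DifferentiableAt ℂ (fun z => (Complex.Gammaℝ z)⁻¹) z :=
      Complex.differentiable_Gammaℝ_inv z
    have h1 : DifferentiableAt ℂ (fun z : ℂ => (z - 1) / z) z :=
      (differentiableAt_id.sub_const 1).div differentiableAt_id h0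
    exact (hΓ.mul ((((((differentiableAt_id.sub_const 1).mul hΛ).sub h1).add_const 1)).mul
      hR)).differentiableWithinAt
  have heq : F =ᶠ[𝓝 2] G := by
    filter_upwards [(isOpen_lt continuous_const Complex.continuous_re).mem_nhds
      (show (1 : ℝ) < (2 : ℂ).re by norm_num)] with z (hz : 1 < z.re)
    have hz1 : z ≠ 1 := by
      rintro rfl
      simp at hz
    rw [hGζ (show 0 < z.re by linarith) hz1]
    simp only [hF]
    rw [mellin_planckRegular_of_one_lt hz]
    have : z - 1 ≠ 0 := sub_ne_zero.2 hz1
    field_simp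
    ring
  have key := hFa.eqOn_of_preconnected_of_eventuallyEq hGa hUc (show (0 : ℝ) < (2 : ℂ).re by norm_num)
    heq hs
  rw [hGζ hs h1] at key
  simp only [hF] at key
  have : s - 1 ≠ 0 := sub_ne_zero.2 h1
  field_simp
  linear_combination key

/-- κ is this tail of 1/u minus `planckRegular`; for Re s < 1 the tail converges, and its 1/(1 - s)
cancels the polar term of `mellin_planckRegular`. -/
lemma hasMellin_indicator_Ioi_one_inv {s : ℂ} (hs1 : s.re < 1) :
    HasMellin (indicator (Ioi 1) fun t : ℝ => (t : ℂ) ^ (-1 : ℂ)) s (1 / (1 - s)) := by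
  have hre : (s - 2).re < -1 := by simp; linarith
  have e : ∀ t ∈ Ioi (0 : ℝ), (t : ℂ) ^ (s - 1) • indicator (Ioi 1)
      (fun t : ℝ => (t : ℂ) ^ (-1 : ℂ)) t = indicator (Ioi 1) (fun t : ℝ => (t : ℂ) ^ (s - 2)) t := by
    intro t (ht : 0 < t)
    by_cases h : t ∈ Ioi (1 : ℝ)
    · rw [indicator_of_mem h, indicator_of_mem h, smul_eq_mul,
        ← Complex.cpow_add _ _ (Complex.ofReal_ne_zero.2 ht.ne')]
      ring_nf
    · rw [indicator_of_notMem h, indicator_of_notMem h, smul_zero]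
  have hss : Ioi (0 : ℝ) ∩ Ioi 1 = Ioi 1 := by
    rw [Ioi_inter_Ioi]; norm_num
  constructor
  · rw [MellinConvergent, integrableOn_congr_fun e measurableSet_Ioi,
      IntegrableOn, integrable_indicator_iff measurableSet_Ioi, IntegrableOn,
      Measure.restrict_restrict measurableSet_Ioi, inter_comm, hss]
    exact integrableOn_Ioi_cpow_of_lt hre one_pos
  · rw [mellin, setIntegral_congr_fun measurableSet_Ioi e, setIntegral_indicator measurableSet_Ioi,
      hss, integral_Ioi_cpow_of_lt hre one_pos, Complex.ofReal_one, Complex.one_cpow,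
      show s - 2 + 1 = -(1 - s) by ring, neg_div_neg_eq]

/-- The Mellin transform of `1 / u - 1 / (e^u - 1)` in the strip `0 < Re s < 1`. -/
theorem hasMellin_binetKernel {s : ℂ} (hs : 0 < s.re) (hs1 : s.re < 1) :
    HasMellin (fun u => (binetKernel u : ℂ)) s (-(Complex.Gamma s * riemannZeta s)) := by
  have hne : s ≠ 1 := by
    rintro rfl
    simp at hs1
  have h1 := hasMellin_indicator_Ioi_one_inv hs1
  have h2 := (mellinConvergent_and_differentiableAt_planckRegular hs).1
  have h3 := hasMellin_sub h1.1 h2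
  have e : EqOn (fun u : ℝ => (u : ℂ) ^ (s - 1) • (binetKernel u : ℂ))
      (fun u => (u : ℂ) ^ (s - 1) • (indicator (Ioi 1) (fun t : ℝ => (t : ℂ) ^ (-1 : ℂ)) u -
        planckRegular u)) (Ioi 0) := by
    intro u (hu : 0 < u)
    simp only
    congr 1
    rcases le_or_gt u 1 with h | h
    · rw [planckRegular_of_le_one hu h, indicator_of_notMem (fun h' : u ∈ Ioi (1 : ℝ) => not_lt.2 h h')]
      ring
    · rw [planckRegular, indicator_of_mem (show u ∈ Ioi (1 : ℝ) from h),
        indicator_of_notMem (fun h' => absurd h'.2 (not_le.2 h)), Complex.cpow_neg_one,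
        binetKernel]
      push_cast
      ring
  refine ⟨(integrableOn_congr_fun e measurableSet_Ioi).2 h3.1, ?_⟩
  rw [mellin, setIntegral_congr_fun measurableSet_Ioi e]
  refine h3.2.trans ?_
  rw [h1.2, mellin_planckRegular hs hne]
  have h4 : s - 1 ≠ 0 := sub_ne_zero.2 hne
  rw [← neg_sub s 1]
  field_simp
  ring

/-! ### Parseval's formula and the Mellin transform of the Laplace side -/

/-- The Parseval formula for the Mellin transform. -/
theorem mellin_parseval {f g : ℝ → ℂ} {σ : ℝ} (hf : MellinConvergent f (1 - σ : ℝ))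
    (hg : MellinConvergent g σ) (hV : Complex.VerticalIntegrable (mellin g) σ)
    (hgc : ContinuousOn g (Ioi 0)) :
    Integrable (fun t : ℝ => mellin f (1 - (σ + t * Complex.I)) * mellin g (σ + t * Complex.I)) ∧
    IntegrableOn (fun v => f v * g v) (Ioi 0) ∧
    ∫ v in Ioi 0, f v * g v = 1 / (2 * Real.pi) *
      ∫ t : ℝ, mellin f (1 - (σ + t * Complex.I)) * mellin g (σ + t * Complex.I) := by
  -- Integrating over v gives the product of Mellin transforms; integrating over t gives 2π f g by
  -- Mellin inversion. As |v^(-it)| = 1, integrability of K reduces to that of a product of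
  -- functions of separate variables.
  set K : ℝ × ℝ → ℂ := fun p => mellin g (σ + p.1 * Complex.I) *
    ((p.2 : ℂ) ^ (-(σ + p.1 * Complex.I)) * f p.2) with hK
  have hf' : Integrable (fun v : ℝ => (v : ℂ) ^ (-σ : ℂ) * f v) (volume.restrict (Ioi 0)) := by
    have : (((1 - σ : ℝ) : ℂ) - 1) = -σ := by push_cast; ring
    rw [MellinConvergent, this] at hf
    exact hf
  have hKi : Integrable K (volume.prod (volume.restrict (Ioi (0 : ℝ)))) := by
    have h1 : Integrable (fun p : ℝ × ℝ => mellin g (σ + p.1 * Complex.I) *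
      ((p.2 : ℂ) ^ (-σ : ℂ) * f p.2)) (volume.prod (volume.restrict (Ioi (0 : ℝ)))) :=
      Integrable.mul_prod hV hf'
    have h2 : Measurable fun p : ℝ × ℝ => (p.2 : ℂ) ^ (-(p.1 * Complex.I)) := by fun_prop
    have hpos : ∀ᵐ p : ℝ × ℝ ∂(volume.prod (volume.restrict (Ioi (0 : ℝ)))), p.2 ∈ Ioi (0 : ℝ) :=
      Measure.quasiMeasurePreserving_snd.ae (ae_restrict_mem measurableSet_Ioi)
    refine (h1.bdd_mul (c := 1) h2.aestronglyMeasurable ?_).congr ?_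
    · filter_upwards [hpos] with p (hp : 0 < p.2)
      rw [Complex.norm_cpow_eq_rpow_re_of_pos hp]
      simp
    · filter_upwards [hpos] with p (hp : 0 < p.2)
      have : (p.2 : ℂ) ^ (-(σ + p.1 * Complex.I)) =
          (p.2 : ℂ) ^ (-(p.1 * Complex.I)) * (p.2 : ℂ) ^ (-σ : ℂ) := by
        rw [← Complex.cpow_add _ _ (Complex.ofReal_ne_zero.2 hp.ne')]
        ring_nf
      simp only [hK, this]
      ring
  have hin (t : ℝ) : ∫ v in Ioi (0 : ℝ), K (t, v) =
      mellin f (1 - (σ + t * Complex.I)) * mellin g (σ + t * Complex.I) := by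
    simp only [hK, integral_const_mul]
    rw [mul_comm]
    congr 2
    ext v
    rw [smul_eq_mul]
    ring_nf
  have hout (v : ℝ) (hv : v ∈ Ioi (0 : ℝ)) : ∫ t : ℝ, K (t, v) = 2 * Real.pi * (f v * g v) := by
    have h := mellinInv_mellin_eq σ g hv hg hV (hgc.continuousAt (Ioi_mem_nhds hv))
    rw [mellinInv, Complex.real_smul] at h
    have e : ∫ t : ℝ, K (t, v) = (∫ y : ℝ, (v : ℂ) ^ (-(σ + y * Complex.I)) •
        mellin g (σ + y * Complex.I)) * f v := by
      rw [← integral_mul_const]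
      congr 1
      ext t
      simp only [hK, smul_eq_mul]
      ring
    rw [e, ← h]
    have : (Real.pi : ℂ) ≠ 0 := Complex.ofReal_ne_zero.2 Real.pi_ne_zero
    generalize (∫ y : ℝ, (v : ℂ) ^ (-(σ + y * Complex.I)) • mellin g (σ + y * Complex.I)) = J
    push_cast
    field_simp
  have h2π : (2 * Real.pi : ℂ) ≠ 0 :=
    mul_ne_zero two_ne_zero (Complex.ofReal_ne_zero.2 Real.pi_ne_zero)
  refine ⟨hKi.integral_prod_left.congr (Eventually.of_forall hin), ?_, ?_⟩
  · have h := hKi.integral_prod_right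
    have h' : IntegrableOn (fun v => ∫ t : ℝ, K (t, v)) (Ioi 0) := h
    rw [integrableOn_congr_fun hout measurableSet_Ioi] at h'
    exact (integrable_const_mul_iff (isUnit_iff_ne_zero.2 h2π) _).1 h'
  · have h := integral_integral_swap (f := fun t v => K (t, v)) hKi
    simp only [hin] at h
    rw [setIntegral_congr_fun measurableSet_Ioi hout, integral_const_mul] at h
    rw [h, one_div, inv_mul_cancel_left₀ h2π]

/-- The Mellin transform of `v^m` times the Laplace transform of `u^m (1 / u - 1 / (e^u - 1))`. -/
theorem hasMellin_pow_mul_binetLaplace (m : ℕ) {s : ℂ} (hs : 0 < s.re) (hs1 : s.re < 1) :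
    HasMellin (fun v => (v : ℂ) ^ m * (binetLaplace m v : ℂ)) s
      (Complex.Gamma (s + m) * -(Complex.Gamma (1 - s) * riemannZeta (1 - s))) := by
  -- Integrating over v first gives Γ(s+m) u^(-s-m); the factor u^m then leaves the Mellin integral
  -- of κ at 1 - s. The norms follow the same computation with Re s, as Tonelli requires.
  set K : ℝ × ℝ → ℂ := fun p => (p.1 : ℂ) ^ (s - 1) * ((p.1 : ℂ) ^ m *
    ((p.2 ^ m * binetKernel p.2 * Real.exp (-(p.1 * p.2)) : ℝ) : ℂ)) with hK
  have hsm : 0 < (s + m).re := by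
    have : (0 : ℝ) ≤ m := m.cast_nonneg
    simp only [Complex.add_re, Complex.natCast_re]
    linarith
  have hM := hasMellin_binetKernel (s := 1 - s) (by simpa using hs1) (by simpa using hs)
  have hKeq {u v : ℝ} (hv : 0 < v) : K (v, u) = ((u ^ m * binetKernel u : ℝ) : ℂ) *
      ((v : ℂ) ^ (s + m - 1) * Complex.exp (-(u * v))) := by
    have : (v : ℂ) ^ (s + m - 1) = (v : ℂ) ^ (s - 1) * (v : ℂ) ^ m := by
      rw [← Complex.cpow_natCast, ← Complex.cpow_add _ _ (Complex.ofReal_ne_zero.2 hv.ne')]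
      ring_nf
    simp only [hK, this]
    push_cast
    ring_nf
  have hKnorm {u v : ℝ} (hu : 0 < u) (hv : 0 < v) : ‖K (v, u)‖ = (u ^ m * binetKernel u) *
      (v ^ ((s + m).re - 1) * Real.exp (-(u * v))) := by
    have := binetKernel_nonneg hu
    rw [hKeq hv, norm_mul, Complex.norm_real, Real.norm_of_nonneg (by positivity), norm_mul,
      Complex.norm_cpow_eq_rpow_re_of_pos hv, Complex.norm_exp]
    simp
  have hKm : Measurable K := by
    have := measurable_binetKernel
    have h2 : Measurable fun p : ℝ × ℝ => binetKernel p.2 := this.comp measurable_snd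
    simp only [hK]
    fun_prop
  have hKi : Integrable K ((volume.restrict (Ioi (0 : ℝ))).prod (volume.restrict (Ioi (0 : ℝ)))) := by
    rw [integrable_prod_iff' hKm.aestronglyMeasurable]
    constructor
    · filter_upwards [ae_restrict_mem measurableSet_Ioi] with u (hu : 0 < u)
      have h1 := integrableOn_rpow_mul_exp_neg_mul_rpow (p := 1) (s := (s + m).re - 1) (b := u)
        (by linarith) one_pos hu
      refine (integrable_norm_iff (hKm.comp (measurable_prodMk_right)).aestronglyMeasurable).1 ?_
      refine (integrableOn_congr_fun (fun v hv => ?_) measurableSet_Ioi).2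
        (h1.const_mul (u ^ m * binetKernel u))
      simp only [Function.comp_apply]
      rw [hKnorm hu hv, Real.rpow_one, neg_mul]
    · have hM' := hM.1.norm.const_mul (Real.Gamma (s + m).re)
      refine hM'.congr ?_
      filter_upwards [ae_restrict_mem measurableSet_Ioi] with u (hu : 0 < u)
      rw [setIntegral_congr_fun measurableSet_Ioi fun v hv => hKnorm hu hv, integral_const_mul,
        Real.integral_rpow_mul_exp_neg_mul_Ioi hsm hu, norm_smul,
        Complex.norm_cpow_eq_rpow_re_of_pos hu, Complex.norm_real,
        Real.norm_of_nonneg (binetKernel_nonneg hu), one_div, Real.inv_rpow hu.le,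
        ← Real.rpow_neg hu.le]
      have : u ^ (1 - s - 1).re = u ^ m * u ^ (-(s + m).re) := by
        rw [← Real.rpow_natCast, ← Real.rpow_add hu]
        simp
      rw [this]
      ring
  have hin (v : ℝ) : ∫ u in Ioi (0 : ℝ), K (v, u) =
      (v : ℂ) ^ (s - 1) • ((v : ℂ) ^ m * (binetLaplace m v : ℂ)) := by
    simp only [hK, integral_const_mul, smul_eq_mul]
    rw [integral_complex_ofReal, binetLaplace]
  have hout (u : ℝ) (hu : u ∈ Ioi (0 : ℝ)) : ∫ v in Ioi (0 : ℝ), K (v, u) =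
      Complex.Gamma (s + m) * ((u : ℂ) ^ (1 - s - 1) • (binetKernel u : ℂ)) := by
    have hu' : 0 < u := hu
    rw [setIntegral_congr_fun measurableSet_Ioi fun v hv => hKeq hv, integral_const_mul,
      Complex.integral_cpow_mul_exp_neg_mul_Ioi hsm hu, one_div, Complex.inv_cpow _ _ (by
        rw [Complex.arg_ofReal_of_nonneg hu'.le]; exact Real.pi_ne_zero.symm), ← Complex.cpow_neg]
    have : (u : ℂ) ^ (1 - s - 1) = (u : ℂ) ^ m * (u : ℂ) ^ (-(s + m)) := by
      rw [← Complex.cpow_natCast, ← Complex.cpow_add _ _ (Complex.ofReal_ne_zero.2 hu'.ne')]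
      ring_nf
    rw [this, smul_eq_mul]
    push_cast
    ring
  constructor
  · exact hKi.integral_prod_left.congr (Eventually.of_forall hin)
  · have h := integral_integral_swap (f := fun v u => K (v, u)) hKi
    simp only [hin] at h
    rw [setIntegral_congr_fun measurableSet_Ioi hout, integral_const_mul] at h
    rw [mellin, h, ← hM.2, mellin]

/-! ### Mellin transform of the Gaussian and its decay -/

lemma mellinConvergent_exp_neg_mul {c : ℝ} (hc : 0 < c) {s : ℂ} (hs : 0 < s.re) :
    MellinConvergent (fun t : ℝ => Complex.exp (-(c * t))) s := by
  have hcont : Continuous fun t : ℝ => Complex.exp (-(c * t)) := by fun_prop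
  refine mellinConvergent_of_isBigO_rpow_exp (b := 0) hc
    (hcont.locallyIntegrable.locallyIntegrableOn _) ?_ ?_ hs
  · refine Asymptotics.IsBigO.of_bound 1 (Eventually.of_forall fun t => ?_)
    rw [Complex.norm_exp]
    simp
  · refine Asymptotics.IsBigO.of_bound 1 ?_
    filter_upwards [self_mem_nhdsWithin] with t (ht : 0 < t)
    rw [Complex.norm_exp]
    have : 0 ≤ c * t := by positivity
    simpa using this

lemma hasMellin_gaussian {c : ℝ} (hc : 0 < c) {s : ℂ} (hs : 0 < s.re) :
    HasMellin (fun t : ℝ => ((Real.exp (-(c * t ^ 2)) : ℝ) : ℂ)) s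
      (1 / 2 * ((1 / c : ℂ) ^ (s / 2) * Complex.Gamma (s / 2))) := by
  have e : (fun t : ℝ => ((Real.exp (-(c * t ^ 2)) : ℝ) : ℂ)) =
      fun t : ℝ => (fun t : ℝ => Complex.exp (-(c * t))) (t ^ (2 : ℝ)) := by
    ext t
    simp
  have hs2 : 0 < (s / 2).re := by simpa using hs
  rw [e]
  constructor
  · refine (MellinConvergent.comp_rpow (f := fun t : ℝ => Complex.exp (-(c * t)))
      two_ne_zero).2 ?_
    simpa using mellinConvergent_exp_neg_mul hc hs2
  · rw [mellin_comp_rpow (fun t : ℝ => Complex.exp (-(c * t))), Complex.ofReal_ofNat]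
    simp only [mellin, smul_eq_mul]
    rw [Complex.integral_cpow_mul_exp_neg_mul_Ioi hs2 hc]
    simp

lemma norm_Gamma_le_real_Gamma {z : ℂ} (hz : 0 < z.re) :
    ‖Complex.Gamma z‖ ≤ Real.Gamma z.re := by
  rw [Complex.Gamma_eq_integral hz, Real.Gamma_eq_integral hz, Complex.GammaIntegral]
  refine (norm_integral_le_integral_norm _).trans (le_of_eq ?_)
  refine setIntegral_congr_fun measurableSet_Ioi fun t ht => ?_
  simp only [norm_mul]
  rw [Complex.norm_cpow_eq_rpow_re_of_pos ht, Complex.norm_real,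
    Real.norm_of_nonneg (Real.exp_nonneg _)]
  simp

/-- Two steps of the recurrence move z from Re z = 1/4 to 9/4, where |Γ| is at most Γ(9/4), and
|z||z+1| ≥ |z|² ≥ (1 + t²)/16. Quadratic decay is enough for Mellin inversion. -/
lemma norm_Gamma_quarter_line_le (t : ℝ) :
    ‖Complex.Gamma ((1 / 2 + t * Complex.I) / 2)‖ ≤ 16 * Real.Gamma (9 / 4) * (1 + t ^ 2)⁻¹ := by
  set z : ℂ := (1 / 2 + t * Complex.I) / 2 with hz
  have hre : z.re = 1 / 4 := by simp [hz]; norm_num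
  have him : z.im = t / 2 := by simp [hz]
  have h0 : z ≠ 0 := fun h => by rw [h] at hre; norm_num at hre
  have h1 : z + 1 ≠ 0 := fun h => by
    have : (z + 1).re = 0 := by rw [h]; rfl
    rw [Complex.add_re, hre] at this
    norm_num at this
  have h2 : ‖Complex.Gamma (z + 1 + 1)‖ ≤ Real.Gamma (9 / 4) := by
    have h := norm_Gamma_le_real_Gamma (z := z + 1 + 1) (by simp [hre]; norm_num)
    have e : (z + 1 + 1).re = 9 / 4 := by simp [hre]; norm_num
    rwa [e] at h
  rw [Complex.Gamma_add_one _ h1, Complex.Gamma_add_one _ h0, norm_mul, norm_mul] at h2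
  have h3 : ‖z‖ ≤ ‖z + 1‖ := by
    rw [← sq_le_sq₀ (norm_nonneg _) (norm_nonneg _), Complex.sq_norm, Complex.sq_norm,
      Complex.normSq_apply, Complex.normSq_apply]
    simp [hre]
    norm_num
  have h4 : (1 + t ^ 2) / 16 ≤ ‖z + 1‖ * ‖z‖ := by
    calc (1 + t ^ 2) / 16 ≤ ‖z‖ ^ 2 := by
          rw [Complex.sq_norm, Complex.normSq_apply, hre, him]
          nlinarith [sq_nonneg t]
      _ = ‖z‖ * ‖z‖ := sq _
      _ ≤ ‖z + 1‖ * ‖z‖ := by gcongr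
  have h5 : (1 + t ^ 2) / 16 * ‖Complex.Gamma z‖ ≤ Real.Gamma (9 / 4) := by
    refine le_trans ?_ h2
    rw [← mul_assoc]
    gcongr
  rw [← div_eq_mul_inv, le_div_iff₀ (by positivity)]
  linarith

lemma verticalIntegrable_mellin_gaussian {c : ℝ} (hc : 0 < c) :
    Complex.VerticalIntegrable
      (mellin fun t : ℝ => ((Real.exp (-(c * t ^ 2)) : ℝ) : ℂ)) (1 / 2 : ℝ) := by
  have hre (t : ℝ) : 0 < (((1 / 2 : ℝ) : ℂ) + t * Complex.I).re := by simp
  have e (t : ℝ) := (hasMellin_gaussian hc (hre t)).2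
  rw [Complex.VerticalIntegrable]
  simp only [e]
  have hc' : (1 / c : ℂ) ≠ 0 := one_div_ne_zero (Complex.ofReal_ne_zero.2 hc.ne')
  have hcont : Continuous fun t : ℝ =>
      (1 / 2 : ℂ) * ((1 / c : ℂ) ^ ((((1 / 2 : ℝ) : ℂ) + t * Complex.I) / 2) *
        Complex.Gamma ((((1 / 2 : ℝ) : ℂ) + t * Complex.I) / 2)) := by
    refine continuous_const.mul (Continuous.mul ?_ ?_)
    · exact Continuous.const_cpow (by fun_prop) (Or.inl hc')
    · refine continuous_iff_continuousAt.2 fun t => ?_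
      refine ContinuousAt.comp (g := Complex.Gamma) ?_ (by fun_prop)
      refine (Complex.differentiableAt_Gamma _ fun m h => ?_).continuousAt
      have h' := congrArg Complex.re h
      have : (0 : ℝ) ≤ m := m.cast_nonneg
      simp at h'
      linarith
  refine ((integrable_inv_one_add_sq.const_mul
    (1 / 2 * ((1 / c) ^ (1 / 4 : ℝ) * (16 * Real.Gamma (9 / 4)))))).mono'
    hcont.aestronglyMeasurable (Eventually.of_forall fun t => ?_)
  have h1 : ‖(1 / c : ℂ) ^ ((((1 / 2 : ℝ) : ℂ) + t * Complex.I) / 2)‖ = (1 / c) ^ (1 / 4 : ℝ) := by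
    have : (1 / c : ℂ) = ((1 / c : ℝ) : ℂ) := by push_cast; rfl
    rw [this, Complex.norm_cpow_eq_rpow_re_of_pos (by positivity)]
    congr 1
    simp
    norm_num
  have h2 := norm_Gamma_quarter_line_le t
  rw [norm_mul, norm_mul, h1]
  have h3 : ((1 / 2 : ℝ) : ℂ) = 1 / 2 := by push_cast; rfl
  rw [h3]
  have h4 : ‖(1 / 2 : ℂ)‖ = 1 / 2 := by simp
  rw [h4]
  calc _ ≤ 1 / 2 * ((1 / c) ^ (1 / 4 : ℝ) * (16 * Real.Gamma (9 / 4) * (1 + t ^ 2)⁻¹)) := by gcongr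
    _ = _ := by ring

/-! ### The function Ξ and the final identity -/

lemma riemannXi_eq_of_re_pos {s : ℂ} (hs : 0 < s.re) :
    riemannXi s = 1 / 2 * s * (s - 1) * completedRiemannZeta s := by
  have h0 : s ≠ 0 := by rintro rfl; simp at hs
  rw [riemannXi, riemannZeta_def_of_ne_zero h0]
  have h1 := Complex.Gammaℝ_ne_zero_of_re_pos hs
  have h2 : (Real.pi : ℂ) ^ (-s / 2) * Complex.Gamma (s / 2) = Complex.Gammaℝ s :=
    (Complex.Gammaℝ_def s).symm
  rw [mul_assoc _ ((Real.pi : ℂ) ^ (-s / 2)), h2]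
  field_simp

lemma bigXi_neg (t : ℝ) : bigXi (-t) = bigXi t := by
  rw [bigXi, bigXi, riemannXi_eq_of_re_pos (by simp), riemannXi_eq_of_re_pos (by simp)]
  have : (1 / 2 + Complex.I * ((-t : ℝ) : ℂ)) = 1 - (1 / 2 + Complex.I * t) := by
    push_cast; ring
  rw [this, completedRiemannZeta_one_sub]
  ring

/-- The half of `xiIntegrand` carrying `e^(-2ixt)`; the other half is its reflection. -/
noncomputable def xiHalfIntegrand (m : ℕ) (x t : ℝ) : ℂ :=
  bigXi t / ((Real.cosh (Real.pi * t) : ℂ) * ((t : ℂ) ^ 2 + 1 / 4)) *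
    (Complex.Gamma (1 / 2 - Complex.I * t + m) / Complex.Gamma (1 / 2 - Complex.I * t) *
        Complex.exp (-2 * Complex.I * x * t))

lemma xiIntegrand_eq (m : ℕ) (x t : ℝ) :
    xiIntegrand m x t = xiHalfIntegrand m x t + xiHalfIntegrand m x (-t) := by
  rw [xiIntegrand, xiHalfIntegrand, xiHalfIntegrand, bigXi_neg, mul_neg, Real.cosh_neg]
  push_cast
  rw [neg_sq]
  ring_nf

lemma Gamma_half_add_mul_Gamma_half_sub (t : ℝ) :
    Complex.Gamma (1 / 2 + t * Complex.I) * Complex.Gamma (1 - (1 / 2 + t * Complex.I)) =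
      Real.pi / (Real.cosh (Real.pi * t) : ℂ) := by
  rw [Complex.Gamma_mul_Gamma_one_sub]
  congr 1
  rw [Complex.ofReal_cosh, ← Complex.cos_mul_I, ← Complex.sin_pi_div_two_sub]
  push_cast
  rw [← Complex.sin_pi_sub]
  ring_nf

lemma one_div_pi_mul_exp_cpow (x : ℝ) (w : ℂ) :
    (1 / ((Real.pi * Real.exp (4 * x) : ℝ) : ℂ)) ^ (w / 2) =
      (Real.pi : ℂ) ^ (-w / 2) * Complex.exp (-2 * x * w) := by
  have h : (1 / ((Real.pi * Real.exp (4 * x) : ℝ) : ℂ)) =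
      ((Real.pi⁻¹ : ℝ) : ℂ) * ((Real.exp (-(4 * x)) : ℝ) : ℂ) := by
    rw [Real.exp_neg]; push_cast; field_simp
  rw [h, Complex.mul_cpow_ofReal_nonneg (by positivity) (by positivity), Complex.ofReal_inv,
    Complex.inv_cpow _ _ (by
      rw [Complex.arg_ofReal_of_nonneg Real.pi_pos.le]; exact Real.pi_ne_zero.symm),
    ← Complex.cpow_neg, neg_div]
  congr 1
  rw [Complex.cpow_def_of_ne_zero (Complex.ofReal_ne_zero.2 (Real.exp_ne_zero _)),
    ← Complex.ofReal_log (Real.exp_nonneg _), Real.log_exp]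
  push_cast
  ring_nf

/-- The sign of -Γ(w)ζ(w) and the Gaussian's 1/2 are absorbed by w(w-1)/2 = -(t² + 1/4)/2 in ξ(w),
and e^(-2xw) = e^(-x) e^(-2ixt). -/
lemma mellin_mul_mellin_eq_xiHalfIntegrand (m : ℕ) (x t : ℝ) :
    mellin (fun v => (v : ℂ) ^ m * (binetLaplace m v : ℂ)) (1 - (1 / 2 + t * Complex.I)) *
      mellin (fun v : ℝ => ((Real.exp (-(Real.pi * Real.exp (4 * x) * v ^ 2)) : ℝ) : ℂ))
        (1 / 2 + t * Complex.I) =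
      Real.pi * Complex.exp (-x) * xiHalfIntegrand m x t := by
  have hΓΓ := Gamma_half_add_mul_Gamma_half_sub t
  have hc : 0 < Real.pi * Real.exp (4 * x) := by positivity
  rw [(hasMellin_pow_mul_binetLaplace m (by simp; norm_num) (by simp)).2,
    (hasMellin_gaussian hc (by simp)).2, one_div_pi_mul_exp_cpow, sub_sub_cancel]
  have hw : (1 / 2 + Complex.I * t : ℂ) = 1 / 2 + t * Complex.I := by ring
  have hw' : (1 / 2 - Complex.I * t : ℂ) = 1 - (1 / 2 + t * Complex.I) := by ring
  rw [xiHalfIntegrand, bigXi, riemannXi, hw, hw']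
  have hexp : Complex.exp (-2 * x * (1 / 2 + t * Complex.I)) =
      Complex.exp (-x) * Complex.exp (-2 * Complex.I * x * t) := by
    rw [← Complex.exp_add]; ring_nf
  have hquad : 1 / 2 * (1 / 2 + t * Complex.I) * (1 / 2 + t * Complex.I - 1) =
      -(1 / 2) * ((t : ℂ) ^ 2 + 1 / 4) := by
    linear_combination (1 / 2 : ℂ) * t ^ 2 * Complex.I_sq
  rw [hexp, hquad]
  set w : ℂ := 1 / 2 + t * Complex.I with hwdef
  have hcosh : (Real.cosh (Real.pi * t) : ℂ) ≠ 0 :=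
    Complex.ofReal_ne_zero.2 (Real.cosh_pos _).ne'
  have ht : (t : ℂ) ^ 2 + 1 / 4 ≠ 0 := by
    have : t ^ 2 + 1 / 4 ≠ 0 := by positivity
    rw [show (t : ℂ) ^ 2 + 1 / 4 = ((t ^ 2 + 1 / 4 : ℝ) : ℂ) by push_cast; rfl]
    exact Complex.ofReal_ne_zero.2 this
  have hΓ : Complex.Gamma (1 - w) ≠ 0 :=
    Complex.Gamma_ne_zero_of_re_pos (by simp [hwdef]; norm_num)
  have hΓw : Complex.Gamma w = Real.pi / ((Real.cosh (Real.pi * t) : ℂ) * Complex.Gamma (1 - w)) := by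
    rw [← div_div, ← hΓΓ, mul_div_cancel_right₀ _ hΓ]
  rw [hΓw]
  generalize (t : ℂ) ^ 2 + 1 / 4 = q at *
  field_simp

lemma hardyIntegrand_eq (m : ℕ) (x : ℝ) {v : ℝ} (hv : 0 < v) :
    hardyIntegrand m x v = (-1) ^ m * ((v : ℂ) ^ m * (binetLaplace m v : ℂ) *
      ((Real.exp (-(Real.pi * Real.exp (4 * x) * v ^ 2)) : ℝ) : ℂ)) := by
  rw [hardyIntegrand, psiBar_eq m hv]
  have : -Real.pi * v ^ 2 * Real.exp (4 * x) = -(Real.pi * Real.exp (4 * x) * v ^ 2) := by ring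
  rw [this]
  ring

lemma integrable_xiHalfIntegrand_and_integral (m : ℕ) (x : ℝ) :
    Integrable (xiHalfIntegrand m x) ∧ IntegrableOn (hardyIntegrand m x) (Ioi 0) ∧
    (-1 : ℂ) ^ m * (Real.exp x : ℂ) * ∫ t in Ioi (0 : ℝ), hardyIntegrand m x t =
      1 / 2 * ∫ t : ℝ, xiHalfIntegrand m x t := by
  have hc : 0 < Real.pi * Real.exp (4 * x) := by positivity
  have hcont : Continuous fun v : ℝ =>
      ((Real.exp (-(Real.pi * Real.exp (4 * x) * v ^ 2)) : ℝ) : ℂ) := by fun_prop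
  -- This abscissa places ζ(w) on the critical line; Parseval's 1/(2π) against the factor π e^(-x)
  -- leaves e^(-x)/2.
  have h := mellin_parseval (σ := 1 / 2)
    (hasMellin_pow_mul_binetLaplace m (s := ((1 - 1 / 2 : ℝ) : ℂ)) (by simp; norm_num)
      (by simp)).1
    (hasMellin_gaussian hc (s := ((1 / 2 : ℝ) : ℂ)) (by simp)).1
    (verticalIntegrable_mellin_gaussian hc) hcont.continuousOn
  have h2 : ((1 / 2 : ℝ) : ℂ) = 1 / 2 := by push_cast; rfl
  simp only [h2, mellin_mul_mellin_eq_xiHalfIntegrand] at h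
  have hπ : (Real.pi : ℂ) ≠ 0 := Complex.ofReal_ne_zero.2 Real.pi_ne_zero
  have hne : (Real.pi : ℂ) * Complex.exp (-x) ≠ 0 := mul_ne_zero hπ (Complex.exp_ne_zero _)
  have e : EqOn (hardyIntegrand m x) _ (Ioi 0) := fun v hv => hardyIntegrand_eq m x hv
  refine ⟨(integrable_const_mul_iff (isUnit_iff_ne_zero.2 hne) _).1 h.1,
    (integrableOn_congr_fun e measurableSet_Ioi).2 (h.2.1.const_mul _), ?_⟩
  rw [setIntegral_congr_fun measurableSet_Ioi e, integral_const_mul, h.2.2, integral_const_mul,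
    Complex.exp_neg, Complex.ofReal_exp]
  have hs : ((-1 : ℂ) ^ m) * (-1) ^ m = 1 := by
    rw [← mul_pow]; simp
  have hx := Complex.exp_ne_zero x
  field_simp
  linear_combination (∫ t : ℝ, xiHalfIntegrand m x t) * hs

theorem theorem1 (m : ℕ) (x : ℝ) :
    ContDiffOn ℝ ∞ psiBarBase (Ioi 0) ∧
    IntegrableOn (hardyIntegrand m x) (Ioi 0) ∧
    IntegrableOn (xiIntegrand m x) (Ioi 0) ∧
    (-1 : ℂ) ^ m * (Real.exp x : ℂ) * ∫ t in Ioi (0 : ℝ), hardyIntegrand m x t =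
      1 / 2 * ∫ t in Ioi (0 : ℝ), xiIntegrand m x t := by
  obtain ⟨h1, h2, h3⟩ := integrable_xiHalfIntegrand_and_integral m x
  have e : xiIntegrand m x = fun t => xiHalfIntegrand m x t + xiHalfIntegrand m x (-t) :=
    funext (xiIntegrand_eq m x)
  refine ⟨contDiffOn_psiBarBase, h2, ?_, ?_⟩
  · rw [e]
    exact (h1.add h1.comp_neg).integrableOn
  · rw [h3, e, integral_add h1.integrableOn h1.comp_neg.integrableOn,
      integral_comp_neg_Ioi, neg_zero, add_comm,
      intervalIntegral.integral_Iic_add_Ioi h1.integrableOn h1.integrableOn]
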